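/- For $n\ge 1$ let $\Omega_n^2$ be the set of all NOT, CNOT and 2-CNOT gates on $n$ lines. Such a gate has a target line $t$ and a set $I\subseteq\{1,\dots,n\}\setminus\{t\}$ of control lines with $|I|=0$ (NOT), $|I|=1$ (CNOT) or $|I|=2$ (2-CNOT); it maps $\langle x_1,\dots,x_n\rangle\in\mathbb Z_2^n$ to the vector obtained by replacing $x_t$ with $x_t\oplus\bigwedge_{i\in I}x_i$, where the empty conjunction equals $1$. A reversible circuit on $n$ lines is a finite (possibly empty) sequence of gates from $\Omega_n^2$ connected in series; it defines the composition $g$ of the transformations of its gates, the first gate acting first, and its complexity is the number of its gates. The circuit realizes a map $f\colon\mathbb Z_2^n\to\mathbb Z_2^n$ without additional inputs (ancilla-free) if there is a permutation $\pi$ of $\{1,\dots,n\}$ such that, for every $x\in\mathbb Z_2^n$, $f(x)=\langle y_{\pi(1)},\dots,y_{\pi(n)}\rangle$ where $y=g(x)$. Let $F(n,0)$ be the set of all maps $\mathbb Z_2^n\to\mathbb Z_2^n$ that can be realized in this way, let $L(f,0)$ be the minimal complexity of a circuit realizing $f\in F(n,0)$ without additional inputs, and let $L(n,0)=\max_{f\in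 F(n,0)}L(f,0)$ be the Shannon complexity function. **Theorem.** $L(n,0)\asymp \dfrac{n2^n}{\log_2 n}$; that is, there are absolute constants $c_1,c_2>0$ such that for all integers $n\ge 2$ $$c_1<\frac{L(n,0)}{n2^n/\log_2 n}<c_2 .$$ -/

import Mathlib

/-- Binary vectors of length `n`, i.e. `ℤ₂ⁿ`. -/
abbrev BinVec (n : ℕ) : Type := Fin n → ZMod 2

/-- A gate on `n` lines of type NOT (no controls), CNOT (one control) or 2-CNOT (two controls):
a target line and a set of at most two control lines, not containing the target. -/
@[ext]
structure RevGate (n : ℕ) where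
  target : Fin n
  controls : Finset (Fin n)
  card_le : controls.card ≤ 2
  target_notMem : target ∉ controls

/-- The transformation `⟨x₁,…,x_t,…,x_n⟩ ↦ ⟨x₁,…,x_t ⊕ ⋀_{i ∈ I} x_i,…,x_n⟩` given by a gate
(the empty conjunction is `1`, so that NOT inverts its target). -/
def RevGate.apply {n : ℕ} (E : RevGate n) (x : BinVec n) : BinVec n :=
  Function.update x E.target (x E.target + ∏ i ∈ E.controls, x i)

/-- A reversible circuit with `n` lines: a finite sequence of gates connected in series.
Its complexity is the number of gates, `List.length`. -/
abbrev RevCircuit (n : ℕ) : Type := List (RevGate n)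

/-- The transformation defined by a circuit; the first gate of the list acts first. -/
def RevCircuit.eval {n : ℕ} (S : RevCircuit n) (x : BinVec n) : BinVec n :=
  S.foldl (fun y E => E.apply y) x

/-- The circuit `S` with `n + q` lines realizes `f : ℤ₂ⁿ → ℤ₂ⁿ` using `q` additional inputs: the
additional inputs are fed with zeros, and for some permutation `π` of the lines the values of `f`
are read off from the lines `π(1), …, π(n)`. -/
def RevCircuit.Realizes {n q : ℕ} (S : RevCircuit (n + q)) (f : BinVec n → BinVec n) : Prop :=
  ∃ π : Equiv.Perm (Fin (n + q)), ∀ (x : BinVec n) (i : Fin n),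
    RevCircuit.eval S (Fin.append x (fun _ : Fin q => 0)) (π (Fin.castAdd q i)) = f x i

/-- `F(n,q)`: all maps `ℤ₂ⁿ → ℤ₂ⁿ` realizable by circuits with `q` additional inputs. -/
def realizableMaps (n q : ℕ) : Set (BinVec n → BinVec n) :=
  {f | ∃ S : RevCircuit (n + q), S.Realizes f}

/-- `L(f,q)`: the least complexity of a circuit realizing `f` with `q` additional inputs
(used only for `f ∈ F(n,q)`). -/
noncomputable def minComplexity {n : ℕ} (f : BinVec n → BinVec n) (q : ℕ) : ℕ :=
  sInf {l | ∃ S : RevCircuit (n + q), S.Realizes f ∧ S.length = l}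

open Classical in
/-- The Shannon complexity function `L(n,q) = max_{f ∈ F(n,q)} L(f,q)`; the maximum is over a
finite set, which contains the identity map. -/
noncomputable def shannonComplexity (n q : ℕ) : ℕ :=
  (Finset.univ.filter (fun f : BinVec n → BinVec n => f ∈ realizableMaps n q)).sup
    (fun f => minComplexity f q)

/-! Upper bound: for `n ≥ 4` every gate is an even permutation of the cube, so it suffices to build
each even permutation `g` cheaply. View `k` distinct vectors as a `k × n` matrix. Only `2 ^ k`
columns are possible, so for `3 * 2 ^ k ≤ n` columns repeat and the repetitions serve as work space:
any `k` distinct vectors can be moved to any others by `O(n)` gates (`Reach.of_injective`). Move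
them onto a subcube where one multi-controlled NOT, itself of cost `O(n)`
(`Computes.controlledNot`), acts as `k / 2` disjoint transpositions. Conjugation then yields any `k
/ 2` disjoint transpositions for `O(n)` gates (`exists_transpositions`). Transpositions `x ↔ g x`
remove `k / 2` points from the support of `g` (`exists_reduction`). With `k` of order `log n`, this
takes `O(2 ^ n / log n)` rounds.

Lower bound: all `(2 ^ n)! / 2` even permutations are realizable, while at most `(n (n + 1) ^ 2 + 1)
^ s * n!` maps are realized by `s` or fewer gates (`factorial_le_of_even_perms_computable`).
Comparing logarithms bounds `s` from below. -/

open Function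

/-! ### Circuits and their reversibility -/

namespace RevCircuit

variable {n : ℕ}

theorem eval_nil (x : BinVec n) : eval ([] : RevCircuit n) x = x := rfl

theorem eval_cons (E : RevGate n) (S : RevCircuit n) (x : BinVec n) :
    eval (E :: S) x = eval S (E.apply x) := rfl

theorem eval_append (S T : RevCircuit n) (x : BinVec n) :
    eval (S ++ T) x = eval T (eval S x) := by
  simp [eval, List.foldl_append]

end RevCircuit

/-- The NOT operation on line `t` controlled by an arbitrary set `I` of lines. -/
def controlledNot {n : ℕ} (t : Fin n) (I : Finset (Fin n)) (x : BinVec n) : BinVec n :=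
  update x t (x t + ∏ i ∈ I, x i)

section controlledNot

variable {n : ℕ} {t : Fin n} {I : Finset (Fin n)}

theorem controlledNot_same (t : Fin n) (I : Finset (Fin n)) (x : BinVec n) :
    controlledNot t I x t = x t + ∏ i ∈ I, x i := by
  simp [controlledNot]

theorem controlledNot_of_ne {i : Fin n} (h : i ≠ t) (I : Finset (Fin n)) (x : BinVec n) :
    controlledNot t I x i = x i := by
  simp [controlledNot, h]

theorem prod_controlledNot {J : Finset (Fin n)} (h : t ∉ J) (I : Finset (Fin n)) (x : BinVec n) :
    ∏ i ∈ J, controlledNot t I x i = ∏ i ∈ J, x i :=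
  Finset.prod_congr rfl fun _ hi => controlledNot_of_ne (ne_of_mem_of_not_mem hi h) I x

theorem controlledNot_involutive (h : t ∉ I) : Involutive (controlledNot t I) := by
  intro x
  ext i
  by_cases hi : i = t
  · subst hi
    rw [controlledNot_same, prod_controlledNot h, controlledNot_same, add_assoc,
      CharTwo.add_self_eq_zero, add_zero]
  · rw [controlledNot_of_ne hi, controlledNot_of_ne hi]

theorem RevGate.apply_eq_controlledNot (E : RevGate n) :
    E.apply = controlledNot E.target E.controls := rfl

end controlledNot

namespace RevCircuit

variable {n : ℕ}

theorem eval_reverse_eval (S : RevCircuit n) (x : BinVec n) :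
    eval S.reverse (eval S x) = x := by
  induction S generalizing x with
  | nil => rfl
  | cons E S ih =>
    rw [List.reverse_cons, eval_append, eval_cons E S x, ih, eval_cons, eval_nil,
      RevGate.apply_eq_controlledNot, controlledNot_involutive E.target_notMem]

theorem eval_injective (S : RevCircuit n) : Injective (eval S) :=
  LeftInverse.injective (eval_reverse_eval S)

end RevCircuit

/-! ### Calculus of gate costs -/

/-- Some circuit with at most `c` gates takes `v j` to `w j` for all `j`. -/
def Reach {n : ℕ} {ι : Type*} (c : ℕ) (v w : ι → BinVec n) : Prop :=
  ∃ S : RevCircuit n, S.length ≤ c ∧ ∀ j, RevCircuit.eval S (v j) = w j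

/-- Some circuit with at most `c` gates defines the transformation `f`. -/
def Computes {n : ℕ} (c : ℕ) (f : BinVec n → BinVec n) : Prop :=
  Reach c id f

section Reach

variable {n : ℕ} {ι : Type*} {c d : ℕ} {u v w : ι → BinVec n}

theorem Reach.refl (v : ι → BinVec n) : Reach 0 v v := ⟨[], le_rfl, fun _ => rfl⟩

theorem Reach.mono (h : Reach c v w) (hcd : c ≤ d) : Reach d v w := by
  obtain ⟨S, hS, h⟩ := h
  exact ⟨S, hS.trans hcd, h⟩

theorem Reach.trans (h₁ : Reach c u v) (h₂ : Reach d v w) : Reach (c + d) u w := by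
  obtain ⟨S, hS, h₁⟩ := h₁
  obtain ⟨T, hT, h₂⟩ := h₂
  refine ⟨S ++ T, by simpa using add_le_add hS hT, fun j => ?_⟩
  rw [RevCircuit.eval_append, h₁, h₂]

theorem Reach.symm (h : Reach c v w) : Reach c w v := by
  obtain ⟨S, hS, h⟩ := h
  exact ⟨S.reverse, by simpa using hS, fun j => by rw [← h, RevCircuit.eval_reverse_eval]⟩

theorem Reach.injective (h : Reach c v w) (hv : Injective v) : Injective w := by
  obtain ⟨S, -, h⟩ := h
  intro i j hij
  rw [← h, ← h] at hij
  exact hv (S.eval_injective hij)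

theorem Reach.gate {t : Fin n} {I : Finset (Fin n)} (ht : t ∉ I) (hI : I.card ≤ 2)
    (v : ι → BinVec n) : Reach 1 v (fun j => controlledNot t I (v j)) :=
  ⟨[⟨t, I, hI, ht⟩], le_rfl, fun _ => rfl⟩

theorem Reach.exists_perm (h : Reach c v w) :
    ∃ g : Equiv.Perm (BinVec n), Computes c g ∧ ∀ j, g (v j) = w j := by
  obtain ⟨S, hS, h⟩ := h
  refine ⟨⟨S.eval, RevCircuit.eval S.reverse, S.eval_reverse_eval, fun x => ?_⟩,
    ⟨S, hS, fun _ => rfl⟩, h⟩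
  simpa using RevCircuit.eval_reverse_eval S.reverse x

theorem Computes.comp {f g : BinVec n → BinVec n} (hf : Computes c f) (hg : Computes d g) :
    Computes (c + d) (g ∘ f) := by
  obtain ⟨T, hT, h⟩ := hg
  exact Reach.trans hf ⟨T, hT, fun j => h (f j)⟩

theorem Computes.mul {f g : Equiv.Perm (BinVec n)} (hf : Computes c f) (hg : Computes d g) :
    Computes (c + d) ⇑(f * g) := by
  rw [Equiv.Perm.coe_mul, add_comm]
  exact hg.comp hf

theorem Computes.inv {g : Equiv.Perm (BinVec n)} (hg : Computes c g) : Computes c ⇑g⁻¹ := by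
  obtain ⟨S, hS, h⟩ := hg.symm
  refine ⟨S, hS, fun x => ?_⟩
  have := h (g⁻¹ x)
  simpa using this

end Reach

/-! ### Moving short tuples of vectors with linearly many gates -/

section Transitivity

variable {n : ℕ} {ι : Type*}

theorem zmod_two_eq_one_of_ne_zero {a : ZMod 2} (h : a ≠ 0) : a = 1 := by
  revert a; decide

/-- A set of functions to `ℤ₂` which contains `1`, is closed under sums and products and separates
points contains all functions. -/
theorem mem_of_closed_of_separates [Finite ι] {V : Set (ι → ZMod 2)} (h1 : 1 ∈ V)
    (hadd : ∀ a ∈ V, ∀ b ∈ V, a + b ∈ V) (hmul : ∀ a ∈ V, ∀ b ∈ V, a * b ∈ V)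
    (hsep : ∀ i j, i ≠ j → ∃ a ∈ V, a i ≠ a j) (f : ι → ZMod 2) : f ∈ V := by
  classical
  have := Fintype.ofFinite ι
  have h0 : (0 : ι → ZMod 2) ∈ V := by
    have := hadd 1 h1 1 h1
    have h2 : (1 + 1 : ι → ZMod 2) = 0 := funext fun _ => CharTwo.add_self_eq_zero 1
    rwa [h2] at this
  have hprod : ∀ (s : Finset ι) (F : ι → ι → ZMod 2), (∀ i ∈ s, F i ∈ V) → ∏ i ∈ s, F i ∈ V :=
    fun s F hF => Finset.prod_induction F (· ∈ V) (fun a b ha hb => hmul a ha b hb) h1 hF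
  have hsum : ∀ (s : Finset ι) (F : ι → ι → ZMod 2), (∀ i ∈ s, F i ∈ V) → ∑ i ∈ s, F i ∈ V :=
    fun s F hF => Finset.sum_induction F (· ∈ V) (fun a b ha hb => hadd a ha b hb) h0 hF
  have hsep' : ∀ i j, i ≠ j → ∃ a ∈ V, a i = 1 ∧ a j = 0 := by
    intro i j hij
    obtain ⟨a, ha, hne⟩ := hsep i j hij
    by_cases hi : a i = 0
    · refine ⟨a + 1, hadd a ha 1 h1, by simp [hi], ?_⟩
      have : a j = 1 := zmod_two_eq_one_of_ne_zero fun h => hne (hi.trans h.symm)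
      simp only [Pi.add_apply, this, Pi.one_apply]
      exact CharTwo.add_self_eq_zero 1
    · have hi' := zmod_two_eq_one_of_ne_zero hi
      refine ⟨a, ha, hi', ?_⟩
      by_contra hj
      exact hne (hi'.trans (zmod_two_eq_one_of_ne_zero hj).symm)
  have hδ : ∀ i, (Pi.single i 1 : ι → ZMod 2) ∈ V := by
    intro i
    choose! F hF using hsep' i
    -- The indicator of `i` is the product of functions equal to `1` at `i` and `0` at `j`, over all
    -- `j ≠ i`.
    have : (Pi.single i 1 : ι → ZMod 2) = ∏ j ∈ Finset.univ.erase i, F j := by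
      ext k
      rw [Finset.prod_apply]
      by_cases hk : k = i
      · subst hk
        rw [Pi.single_eq_same, Finset.prod_eq_one]
        exact fun j hj => (hF j (Finset.ne_of_mem_erase hj).symm).2.1
      · rw [Pi.single_eq_of_ne hk]
        symm
        apply Finset.prod_eq_zero (Finset.mem_erase.2 ⟨hk, Finset.mem_univ k⟩)
        exact (hF k (Ne.symm hk)).2.2
    rw [this]
    exact hprod _ _ fun j hj => (hF j (Finset.ne_of_mem_erase hj).symm).1
  have hf : f = ∑ i ∈ Finset.univ.filter (fun i => f i ≠ 0), Pi.single i 1 := by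
    ext k
    rw [Finset.sum_apply, Finset.sum_pi_single]
    by_cases hk : f k = 0
    · simp [hk]
    · simp [zmod_two_eq_one_of_ne_zero hk]
  rw [hf]
  exact hsum _ _ fun i _ => hδ i

/-- If every column occurs among the lines `pos r`, all other lines can be changed arbitrarily. -/
theorem Reach.of_column_position {v w : ι → BinVec n} (pos : (ι → ZMod 2) → Fin n)
    (hpos : ∀ r j, v j (pos r) = r j) (hw : ∀ r j, w j (pos r) = r j) : Reach n v w := by
  classical
  -- `T` is the set of lines already corrected.
  have key : ∀ T : Finset (Fin n),
      Reach T.card v (fun j i => if i ∈ T then w j i else v j i) := by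
    intro T
    induction T using Finset.induction_on with
    | empty => simpa using Reach.refl v
    | insert a T ha ih =>
      rw [Finset.card_insert_of_notMem ha]
      refine ih.trans ?_
      -- Line `p` carries the difference column needed on line `a`, before and after correction, so
      -- one CNOT suffices. If `a = p`, both tuples carry that same column there and no gate is
      -- needed.
      set p := pos (fun j => v j a + w j a) with hp
      by_cases hap : a = p
      · refine Reach.mono (c := 0) ?_ zero_le_one
        convert Reach.refl _ using 3 with j i
        by_cases hi : i = a
        · have h1 := hpos (fun j => v j a + w j a) j
          have h2 := hw (fun j => v j a + w j a) j
          rw [← hp, ← hap] at h1 h2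
          simp only [hi, Finset.mem_insert_self, if_true, ha, if_false]
          exact h2.trans h1.symm
        · simp [hi]
      · convert Reach.gate (t := a) (I := {p}) (by simpa using hap) (by simp) _ using 3
          with j i
        by_cases hi : i = a
        · subst hi
          have hx : (if p ∈ T then w j p else v j p) = v j i + w j i := by
            rw [hp, hpos, hw, ite_self]
          rw [controlledNot_same, Finset.prod_singleton, hx]
          simp only [Finset.mem_insert_self, if_true, ha, if_false]
          rw [← add_assoc, CharTwo.add_self_eq_zero, zero_add]
        · rw [controlledNot_of_ne hi]
          simp [hi]
  simpa using key Finset.univ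

/-- A redundant line can be given any column which is `1`, a sum or a product of two columns. -/
theorem Reach.update_redundant {v : ι → BinVec n} {t t' : Fin n} (htt' : t ≠ t')
    (heq : ∀ j, v j t = v j t') {r : ι → ZMod 2}
    (hr : r = 1 ∨ (∃ a b, a ≠ t ∧ b ≠ t ∧ ∀ j, r j = v j a + v j b) ∨
      ∃ a b, a ≠ t ∧ b ≠ t ∧ ∀ j, r j = v j a * v j b) :
    Reach 3 v (fun j => update (v j) t (r j)) := by
  classical
  have hzero : Reach 1 v (fun j => update (v j) t 0) := by
    convert Reach.gate (t := t) (I := {t'}) (by simpa using htt') (by simp) v using 2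
      with j
    rw [controlledNot, Finset.prod_singleton, ← heq, CharTwo.add_self_eq_zero]
  have hstep : ∀ (s : ι → ZMod 2) (I : Finset (Fin n)), t ∉ I → I.card ≤ 2 →
      Reach 1 (fun j => update (v j) t (s j))
        (fun j => update (v j) t (s j + ∏ i ∈ I, v j i)) := by
    intro s I ht hI
    convert Reach.gate ht hI _ using 2 with j
    rw [controlledNot, update_idem, update_self, Finset.prod_congr rfl]
    intro i hi
    rw [update_of_ne (ne_of_mem_of_not_mem hi ht)]
  rcases hr with rfl | ⟨a, b, ha, hb, h⟩ | ⟨a, b, ha, hb, h⟩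
  · have := hstep 0 ∅ (by simp) (by simp)
    simp only [Finset.prod_empty, Pi.zero_apply, zero_add] at this
    exact (hzero.trans this).mono (by norm_num)
  · have h1 := hstep 0 {a} (by simpa using ha.symm) (by simp)
    have h2 := hstep (fun j => v j a) {b} (by simpa using hb.symm) (by simp)
    simp only [Finset.prod_singleton, Pi.zero_apply, zero_add] at h1 h2
    simp only [h]
    exact (hzero.trans h1).trans h2
  -- Controls form a set, so a repeated factor needs a CNOT instead.
  · by_cases hab : a = b
    · have h1 := hstep 0 {a} (by simpa using ha.symm) (by simp)
      simp only [Finset.prod_singleton, Pi.zero_apply, zero_add] at h1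
      have hsq : ∀ z : ZMod 2, z * z = z := by decide
      simp only [h, ← hab, hsq]
      exact (hzero.trans h1).mono (by norm_num)
    · have h1 := hstep 0 {a, b} (by simpa using ⟨ha.symm, hb.symm⟩) Finset.card_le_two
      simp only [Finset.prod_pair hab, Pi.zero_apply, zero_add] at h1
      simp only [h]
      exact (hzero.trans h1).mono (by norm_num)

/-- With enough lines, all columns can be produced from the columns of distinct vectors. -/
theorem Reach.exists_surjective_columns [Fintype ι] {v : ι → BinVec n} (hv : Injective v)
    (hn : 2 ^ Fintype.card ι < n) :
    ∃ w : ι → BinVec n, Reach (3 * 2 ^ Fintype.card ι) v w ∧ Surjective fun i j => w j i := by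
  classical
  -- Induction on a bound `d` for the number of missing columns; each new one costs 3 gates.
  have key : ∀ (d : ℕ) (v : ι → BinVec n), Injective v →
      (Finset.univ \ Finset.univ.image (fun i j => v j i)).card ≤ d →
      ∃ w : ι → BinVec n, Reach (3 * d) v w ∧ Surjective fun i j => w j i := by
    intro d
    induction d with
    | zero =>
      intro v _ hd
      refine ⟨v, Reach.refl v, fun r => ?_⟩
      have := Finset.eq_empty_iff_forall_notMem.1 (Finset.card_eq_zero.1 (Nat.le_zero.1 hd)) r
      simpa using this
    | succ d ih =>
      intro v hv hd
      by_cases hs : Surjective fun i j => v j i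
      · exact ⟨v, (Reach.refl v).mono (Nat.zero_le _), hs⟩
      obtain ⟨t, t', htt', heq⟩ := Fintype.exists_ne_map_eq_of_card_lt (fun i j => v j i)
        (by simpa [ZMod.card] using hn)
      have heq' : ∀ j, v j t = v j t' := congrFun heq
      -- Line `t` is about to be overwritten; its column survives on `t'`.
      have havoid : ∀ a, ∃ a', a' ≠ t ∧ ∀ j, v j a = v j a' := by
        intro a
        by_cases ha : a = t
        · exact ⟨t', htt'.symm, fun j => ha ▸ heq' j⟩
        · exact ⟨a, ha, fun _ => rfl⟩
      choose av hav hav' using havoid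
      obtain ⟨r, hrV, hr⟩ : ∃ r : ι → ZMod 2, (∀ i, r ≠ fun j => v j i) ∧
          (r = 1 ∨ (∃ a b, a ≠ t ∧ b ≠ t ∧ ∀ j, r j = v j a + v j b) ∨
            ∃ a b, a ≠ t ∧ b ≠ t ∧ ∀ j, r j = v j a * v j b) := by
        -- Otherwise the columns present are closed under the operations and separate indices (as
        -- `v` is injective), so none is missing.
        by_contra! hcon
        refine hs fun f => ?_
        refine mem_of_closed_of_separates (V := Set.range fun i j => v j i) ?_ ?_ ?_ ?_ f
        · by_contra h
          exact (hcon 1 fun i e => h ⟨i, e.symm⟩).1 rfl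
        · rintro _ ⟨a, rfl⟩ _ ⟨b, rfl⟩
          by_contra h
          obtain ⟨j, hj⟩ := (hcon _ fun i e => h ⟨i, e.symm⟩).2.1 _ _ (hav a) (hav b)
          exact hj (by simp [← hav'])
        · rintro _ ⟨a, rfl⟩ _ ⟨b, rfl⟩
          by_contra h
          obtain ⟨j, hj⟩ := (hcon _ fun i e => h ⟨i, e.symm⟩).2.2 _ _ (hav a) (hav b)
          exact hj (by simp [← hav'])
        · intro i j hij
          by_contra! h
          exact hij (hv (funext fun k => h _ ⟨k, rfl⟩))
      have hreach := Reach.update_redundant htt' heq' hr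
      obtain ⟨w, hw, hws⟩ := ih _ (hreach.injective hv) (by
        refine Nat.le_of_lt_succ (lt_of_lt_of_le (Finset.card_lt_card ?_) hd)
        rw [Finset.ssubset_iff_of_subset]
        · refine ⟨r, by simpa using fun i e => hrV i e.symm, ?_⟩
          simp only [Finset.mem_sdiff, Finset.mem_univ, true_and, Finset.mem_image, not_not]
          exact ⟨t, funext fun j => update_self _ _ _⟩
        · refine Finset.sdiff_subset_sdiff le_rfl fun f hf => ?_
          obtain ⟨i, -, rfl⟩ := Finset.mem_image.1 hf
          refine Finset.mem_image.2 ⟨av i, Finset.mem_univ _, ?_⟩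
          exact funext fun j => (update_of_ne (hav i) _ _).trans (hav' i j).symm)
      exact ⟨w, (hreach.trans hw).mono (by omega), hws⟩
  refine key _ v hv ?_
  refine (Finset.card_le_univ _).trans ?_
  simp [ZMod.card]

/-- Any tuple of distinct vectors can be taken to any other one by linearly many gates, if its
size is at most logarithmic. -/
theorem Reach.of_injective [Fintype ι] {v w : ι → BinVec n} (hv : Injective v) (hw : Injective w)
    (hn : 3 * 2 ^ Fintype.card ι ≤ n) : Reach (5 * n) v w := by
  classical
  have hpos : 0 < 2 ^ Fintype.card ι := by positivity
  obtain ⟨F, hF, hFs⟩ := Reach.exists_surjective_columns hv (by omega)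
  obtain ⟨G, hG, hGs⟩ := Reach.exists_surjective_columns hw (by omega)
  choose p hp using hFs
  choose q hq using hGs
  have hcard : Fintype.card (ι → ZMod 2) = 2 ^ Fintype.card ι := by simp [ZMod.card]
  -- Fresh lines, disjoint from `p` and `q`, on which both tuples receive the same complete list of
  -- columns; using these as sources, all the other lines can be matched.
  obtain ⟨e, he⟩ := Function.Embedding.exists_of_card_le_finset
    (α := ι → ZMod 2) (s := (Finset.univ.image p ∪ Finset.univ.image q)ᶜ) (by
      rw [Finset.card_compl, Fintype.card_fin, hcard]
      have h1 := Finset.card_union_le (Finset.univ.image p) (Finset.univ.image q)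
      have h2 := Finset.card_image_le (s := Finset.univ) (f := p)
      have h3 := Finset.card_image_le (s := Finset.univ) (f := q)
      rw [Finset.card_univ, hcard] at h2 h3
      omega)
  have hep : ∀ r, ¬∃ s, e s = p r := by
    rintro r ⟨s, hs⟩
    have := he ⟨s, rfl⟩
    simp [hs] at this
  have heq : ∀ r, ¬∃ s, e s = q r := by
    rintro r ⟨s, hs⟩
    have := he ⟨s, rfl⟩
    simp [hs] at this
  have h1 : Reach n F (fun j => extend e (fun r => r j) (F j)) :=
    Reach.of_column_position p (fun r j => congrFun (hp r) j)
      (fun r j => by rw [extend_apply' _ _ _ (hep r)]; exact congrFun (hp r) j)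
  have h2 : Reach n G (fun j => extend e (fun r => r j) (G j)) :=
    Reach.of_column_position q (fun r j => congrFun (hq r) j)
      (fun r j => by rw [extend_apply' _ _ _ (heq r)]; exact congrFun (hq r) j)
  have h3 : Reach n (fun j => extend e (fun r => r j) (F j))
      (fun j => extend e (fun r : ι → ZMod 2 => r j) (G j)) :=
    Reach.of_column_position e (fun r j => e.injective.extend_apply _ _ _)
      (fun r j => e.injective.extend_apply _ _ _)
  exact ((((hF.trans h1).trans h3).trans h2.symm).trans hG.symm).mono (by omega)

end Transitivity

/-! ### Multi-controlled NOT with linearly many gates -/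

section MultiControlled

variable {n : ℕ}

theorem Computes.gate {t : Fin n} {I : Finset (Fin n)} (ht : t ∉ I) (hI : I.card ≤ 2) :
    Computes 1 (controlledNot t I) :=
  Reach.gate ht hI id

/-- A ladder of gates adds the conjunction of the lines `c 0, …, c j` to the line `a j` for all
`j ≤ k` simultaneously. -/
theorem exists_ladder (a c : ℕ → Fin n) (k : ℕ) (ha : Set.InjOn a (Set.Iic k))
    (hac : ∀ i ≤ k, ∀ j ≤ k, a i ≠ c j) :
    ∃ S : RevCircuit n, S.length ≤ 2 * k + 1 ∧ ∀ x,
      (∀ j ≤ k, S.eval x (a j) = x (a j) + ∏ l ∈ Finset.range (j + 1), x (c l)) ∧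
      ∀ i, (∀ j ≤ k, i ≠ a j) → S.eval x i = x i := by
  induction k with
  | zero =>
    refine ⟨[⟨a 0, {c 0}, by simp, by simpa using hac 0 le_rfl 0 le_rfl⟩], by simp, fun x => ?_⟩
    simp only [RevCircuit.eval_cons, RevCircuit.eval_nil, RevGate.apply_eq_controlledNot]
    refine ⟨fun j hj => ?_, fun i hi => controlledNot_of_ne (hi 0 le_rfl) _ _⟩
    obtain rfl := Nat.le_zero.1 hj
    simp [controlledNot_same]
  | succ k ih =>
    obtain ⟨S, hS, hx⟩ := ih (ha.mono (Set.Iic_subset_Iic.2 k.le_succ))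
      (fun i hi j hj => hac i (hi.trans k.le_succ) j (hj.trans k.le_succ))
    have hinj : ∀ j ≤ k, a (k + 1) ≠ a j := fun j hj e => by
      have := ha (Set.mem_Iic.2 le_rfl) (Set.mem_Iic.2 (hj.trans k.le_succ)) e
      omega
    have hne : a k ≠ c (k + 1) := hac k k.le_succ _ le_rfl
    let E : RevGate n := ⟨a (k + 1), {a k, c (k + 1)}, Finset.card_le_two, by
      simpa using ⟨hinj k le_rfl, hac _ le_rfl _ le_rfl⟩⟩
    have hEsame : ∀ x, E.apply x (a (k + 1)) = x (a (k + 1)) + x (a k) * x (c (k + 1)) := fun x => by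
      rw [RevGate.apply_eq_controlledNot, controlledNot_same, Finset.prod_pair hne]
    have hEne : ∀ x i, i ≠ a (k + 1) → E.apply x i = x i := fun x i hi => by
      rw [RevGate.apply_eq_controlledNot, controlledNot_of_ne hi]
    -- `E` adds `a k * c (k + 1)` before and after `S` changes line `a k`; the old value of `a k`
    -- cancels and only the conjunction remains.
    refine ⟨E :: (S ++ [E]), by simp; omega, fun x => ?_⟩
    simp only [RevCircuit.eval_cons, RevCircuit.eval_append, RevCircuit.eval_nil]
    obtain ⟨h1, h2⟩ := hx (E.apply x)
    have hprod : ∀ j ≤ k, ∏ l ∈ Finset.range (j + 1), E.apply x (c l) =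
        ∏ l ∈ Finset.range (j + 1), x (c l) := fun j hj =>
      Finset.prod_congr rfl fun l hl => hEne _ _
        (hac _ le_rfl _ (by have := Finset.mem_range.1 hl; omega)).symm
    refine ⟨fun j hj => ?_, fun i hi => ?_⟩
    · rcases Nat.le_succ_iff.1 hj with hj | rfl
      · rw [hEne _ _ (hinj j hj).symm, h1 j hj, hprod j hj, hEne _ _ (hinj j hj).symm]
      · rw [hEsame, h1 k le_rfl, h2 _ hinj, h2 (c (k + 1)) (fun j hj => (hac j (hj.trans k.le_succ)
          _ le_rfl).symm), hprod k le_rfl, hEsame, hEne _ _ (hinj k le_rfl).symm,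
          hEne _ _ (hac _ le_rfl _ le_rfl).symm, Finset.prod_range_succ _ (k + 1)]
        linear_combination CharTwo.add_self_eq_zero (x (a k) * x (c (k + 1)))
    · rw [hEne _ _ (hi _ le_rfl), h2 i fun j hj => hi j (hj.trans k.le_succ), hEne _ _ (hi _ le_rfl)]

theorem Finset.exists_enumeration {α : Type*} [DecidableEq α] [Nonempty α] (s : Finset α) :
    ∃ f : ℕ → α, Set.InjOn f (Set.Iio s.card) ∧ (Finset.range s.card).image f = s := by
  induction s using Finset.induction_on with
  | empty => exact ⟨fun _ => Classical.arbitrary α, by simp, by simp⟩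
  | insert b s hb ih =>
    obtain ⟨f, hf, hfs⟩ := ih
    have hmem : ∀ i < s.card, f i ∈ s := fun i hi => by
      rw [← hfs]; exact Finset.mem_image_of_mem _ (Finset.mem_range.2 hi)
    have hcongr : (Finset.range s.card).image (update f s.card b) = s :=
      (Finset.image_congr fun i hi =>
        update_of_ne (Nat.ne_of_lt (Finset.mem_range.1 hi)) _ _).trans hfs
    refine ⟨update f s.card b, ?_, ?_⟩
    · rw [Finset.card_insert_of_notMem hb]
      intro i hi j hj hij
      rw [Set.mem_Iio, Nat.lt_succ_iff_lt_or_eq] at hi hj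
      rcases hi with hi | rfl <;> rcases hj with hj | rfl
      · rw [update_of_ne hi.ne, update_of_ne hj.ne] at hij
        exact hf hi hj hij
      · rw [update_of_ne hi.ne, update_self] at hij
        exact (hb (hij ▸ hmem i hi)).elim
      · rw [update_of_ne hj.ne, update_self] at hij
        exact (hb (hij ▸ hmem j hj)).elim
      · rfl
    · rw [Finset.card_insert_of_notMem hb, Finset.range_add_one, Finset.image_insert, hcongr,
        update_self]

/-- A multi-controlled NOT costs linearly many gates if there are enough further lines. -/
theorem Computes.controlledNot_of_ancillas {t : Fin n} {I A : Finset (Fin n)} (ht : t ∉ I)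
    (hA : t ∉ A) (hIA : Disjoint I A) (hcard : I.card ≤ A.card + 1) :
    Computes (4 * I.card + 1) (controlledNot t I) := by
  rcases Nat.lt_or_ge I.card 2 with hI | hI
  · exact (Computes.gate ht hI.le).mono (by omega)
  obtain ⟨k, hk⟩ : ∃ k, I.card = k + 2 := ⟨I.card - 2, by omega⟩
  obtain ⟨A', hA', hA'card⟩ := Finset.exists_subset_card_eq (s := A) (n := k + 1) (by omega)
  have : Nonempty (Fin n) := ⟨t⟩
  obtain ⟨c, hc, hcI⟩ := Finset.exists_enumeration I
  obtain ⟨b, hb, hbA⟩ := Finset.exists_enumeration A'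
  rw [hk] at hc hcI
  rw [hA'card] at hb hbA
  have hbmem : ∀ i ≤ k, b i ∈ A := fun i hi => by
    apply hA'; rw [← hbA]; exact Finset.mem_image_of_mem _ (Finset.mem_range.2 (by omega))
  have hcmem : ∀ i ≤ k + 1, c i ∈ I := fun i hi => by
    rw [← hcI]; exact Finset.mem_image_of_mem _ (Finset.mem_range.2 (by omega))
  -- The target is the last rung. A second ladder, one rung shorter, then restores the auxiliary
  -- lines, whose initial values are arbitrary.
  set a := update b (k + 1) t with ha
  have hak : ∀ i ≤ k, a i = b i := fun i hi => update_of_ne (by omega) _ _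
  have hak1 : a (k + 1) = t := update_self _ _ _
  have hainj : Set.InjOn a (Set.Iic (k + 1)) := by
    intro i hi j hj hij
    rw [Set.mem_Iic, Nat.le_succ_iff] at hi hj
    rcases hi with hi | rfl <;> rcases hj with hj | rfl
    · rw [hak i hi, hak j hj] at hij
      exact hb (Set.mem_Iio.2 (by omega)) (Set.mem_Iio.2 (by omega)) hij
    · rw [hak i hi, hak1] at hij
      exact (hA (hij ▸ hbmem i hi)).elim
    · rw [hak j hj, hak1] at hij
      exact (hA (hij ▸ hbmem j hj)).elim
    · rfl
  have hac : ∀ i ≤ k + 1, ∀ j ≤ k + 1, a i ≠ c j := by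
    intro i hi j hj e
    rcases Nat.le_succ_iff.1 hi with hi | rfl
    · rw [hak i hi] at e
      exact Finset.disjoint_left.1 hIA (hcmem j hj) (e ▸ hbmem i hi)
    · rw [hak1] at e
      exact ht (e ▸ hcmem j hj)
  obtain ⟨S, hS, hSx⟩ := exists_ladder a c (k + 1) hainj hac
  obtain ⟨T, hT, hTx⟩ := exists_ladder a c k (hainj.mono (Set.Iic_subset_Iic.2 k.le_succ))
    (fun i hi j hj => hac i (hi.trans k.le_succ) j (hj.trans k.le_succ))
  refine ⟨S ++ T, by simp; omega, fun x => ?_⟩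
  rw [RevCircuit.eval_append, id]
  obtain ⟨hS1, hS2⟩ := hSx x
  obtain ⟨hT1, hT2⟩ := hTx (S.eval x)
  have hSc : ∀ l ≤ k + 1, S.eval x (c l) = x (c l) := fun l hl =>
    hS2 _ fun j hj => (hac j hj l hl).symm
  ext i
  by_cases hi : ∃ j ≤ k, i = a j
  · obtain ⟨j, hj, rfl⟩ := hi
    have hjt : a j ≠ t := fun e => hA (e ▸ hak j hj ▸ hbmem j hj)
    rw [hT1 j hj, hS1 j (hj.trans k.le_succ), controlledNot_of_ne hjt, add_assoc,
      Finset.prod_congr rfl (fun l hl => hSc l (by have := Finset.mem_range.1 hl; omega)),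
      CharTwo.add_self_eq_zero, add_zero]
  · push Not at hi
    rw [hT2 i hi]
    by_cases hit : i = t
    · rw [hit, ← hak1, hS1 _ le_rfl, hak1, controlledNot_same, ← hcI, Finset.prod_image]
      intro l hl m hm
      exact hc (by simpa using hl) (by simpa using hm)
    · rw [controlledNot_of_ne hit]
      refine hS2 i fun j hj => ?_
      rcases Nat.le_succ_iff.1 hj with hj | rfl
      · exact hi j hj
      · rwa [hak1]

/-- A commutator: the unknown value of `b` enters twice and cancels, and `b` is restored. -/
theorem controlledNot_union {t b : Fin n} {I J : Finset (Fin n)} (hIJ : Disjoint I J)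
    (htI : t ∉ I) (htJ : t ∉ J) (hbI : b ∉ I) (hbJ : b ∉ J) (hbt : b ≠ t) :
    controlledNot t (I ∪ J) = (controlledNot t (insert b J) ∘ controlledNot b I) ∘
      (controlledNot t (insert b J) ∘ controlledNot b I) := by
  ext x i
  simp only [comp_apply]
  set x1 := controlledNot b I x with hx1
  set x2 := controlledNot t (insert b J) x1 with hx2
  set x3 := controlledNot b I x2 with hx3
  by_cases hit : i = t
  · subst hit
    have h1 : x1 i = x i := controlledNot_of_ne hbt.symm _ _
    have h1b : x1 b = x b + ∏ l ∈ I, x l := controlledNot_same _ _ _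
    have h2 : x2 i = x i + (x b + ∏ l ∈ I, x l) * ∏ l ∈ J, x l := by
      rw [hx2, controlledNot_same, Finset.prod_insert hbJ, h1, h1b, hx1, prod_controlledNot hbJ]
    have h3 : x3 i = x2 i := controlledNot_of_ne hbt.symm _ _
    have h3b : x3 b = x b + ∏ l ∈ I, x l + ∏ l ∈ I, x l := by
      rw [hx3, controlledNot_same, hx2, prod_controlledNot htI, controlledNot_of_ne hbt, h1b, hx1,
        prod_controlledNot hbI]
    have h3J : ∏ l ∈ J, x3 l = ∏ l ∈ J, x l := by
      rw [hx3, prod_controlledNot hbJ, hx2, prod_controlledNot htJ, hx1, prod_controlledNot hbJ]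
    rw [controlledNot_same, controlledNot_same, Finset.prod_insert hbJ, h3, h2, h3b, h3J,
      Finset.prod_union hIJ]
    linear_combination - CharTwo.add_self_eq_zero (x b * ∏ l ∈ J, x l) -
      CharTwo.add_self_eq_zero ((∏ l ∈ I, x l) * ∏ l ∈ J, x l)
  · rw [controlledNot_of_ne hit, controlledNot_of_ne hit]
    by_cases hib : i = b
    · subst hib
      rw [hx3, controlledNot_same, hx2, prod_controlledNot htI, controlledNot_of_ne hit, hx1,
        prod_controlledNot hbI, controlledNot_same, add_assoc, CharTwo.add_self_eq_zero, add_zero]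
    · rw [hx3, controlledNot_of_ne hib, hx2, controlledNot_of_ne hit, hx1, controlledNot_of_ne hib]

/-- A multi-controlled NOT which leaves one line free costs linearly many gates. -/
theorem Computes.controlledNot {t b : Fin n} {I : Finset (Fin n)} (ht : t ∉ I) (hb : b ∉ I)
    (hbt : b ≠ t) : Computes (8 * n) (controlledNot t I) := by
  have hcardI : I.card + 2 ≤ n := by
    have : (insert b (insert t I)).card ≤ n := by
      simpa using Finset.card_le_univ (insert b (insert t I))
    rwa [Finset.card_insert_of_notMem (by simp [hb, hbt]), Finset.card_insert_of_notMem ht] at this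
  -- With `I` halved, the lines of either half serve as auxiliary lines for the gate controlled by
  -- the other.
  obtain ⟨J, hJ, hJcard⟩ := Finset.exists_subset_card_eq (s := I) (n := I.card / 2) (by omega)
  have hcard : (I \ J).card = I.card - I.card / 2 := by
    rw [Finset.card_sdiff_of_subset hJ, hJcard]
  have htJ : t ∉ J := fun h => ht (hJ h)
  have hbJ : b ∉ J := fun h => hb (hJ h)
  have htI' : t ∉ I \ J := fun h => ht (Finset.sdiff_subset h)
  have hbI' : b ∉ I \ J := fun h => hb (Finset.sdiff_subset h)
  have h1 : Computes _ (_root_.controlledNot b (I \ J)) :=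
    Computes.controlledNot_of_ancillas (A := insert t J) hbI' (by simp [hbt, hbJ])
      (by rw [Finset.disjoint_insert_right]; exact ⟨htI', Finset.sdiff_disjoint⟩)
      (by rw [Finset.card_insert_of_notMem htJ]; omega)
  have h2 : Computes _ (_root_.controlledNot t (insert b J)) :=
    Computes.controlledNot_of_ancillas (A := I \ J) (by simp [hbt.symm, htJ]) htI'
      (by rw [Finset.disjoint_insert_left]; exact ⟨hbI', Finset.disjoint_sdiff⟩)
      (by rw [Finset.card_insert_of_notMem hbJ]; omega)
  rw [Finset.card_insert_of_notMem hbJ] at h2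
  have := controlledNot_union (Finset.sdiff_disjoint (s := J) (t := I)) htI' htJ hbI' hbJ hbt
  rw [Finset.sdiff_union_of_subset hJ] at this
  rw [this]
  exact ((h1.comp h2).comp (h1.comp h2)).mono (by omega)

end MultiControlled

/-! ### Parity, and synthesis of even permutations -/

section EvenPermutations

variable {n : ℕ}

/-- The permutation of `ℤ₂ⁿ` defined by a multi-controlled NOT. -/
def controlledNotPerm {t : Fin n} {I : Finset (Fin n)} (ht : t ∉ I) : Equiv.Perm (BinVec n) :=
  (controlledNot_involutive ht).toPerm

/-- Splitting by the value of the free line `b` gives two factors conjugate under NOT on `b`, hence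
of equal sign. -/
theorem sign_controlledNotPerm {t b : Fin n} {I : Finset (Fin n)} (ht : t ∉ I) (hb : b ∉ I)
    (hbt : b ≠ t) : Equiv.Perm.sign (controlledNotPerm ht) = 1 := by
  have htb : t ∉ insert b I := by simp [hbt.symm, ht]
  have key : controlledNotPerm ht = controlledNotPerm htb *
      (controlledNotPerm (Finset.notMem_empty b) * controlledNotPerm htb *
        controlledNotPerm (Finset.notMem_empty b)) := by
    ext x i
    simp only [Equiv.Perm.mul_apply, controlledNotPerm, Involutive.coe_toPerm]
    set x1 := controlledNot b ∅ x with hx1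
    set x2 := controlledNot t (insert b I) x1 with hx2
    set x3 := controlledNot b ∅ x2 with hx3
    have h1b : x1 b = x b + 1 := by rw [hx1, controlledNot_same, Finset.prod_empty]
    have h1 : ∀ i, i ≠ b → x1 i = x i := fun i hi => controlledNot_of_ne hi _ _
    have h2t : x2 t = x t + (x b + 1) * ∏ l ∈ I, x l := by
      rw [hx2, controlledNot_same, Finset.prod_insert hb, h1b, h1 t hbt.symm, hx1,
        prod_controlledNot hb]
    have h2 : ∀ i, i ≠ t → x2 i = x1 i := fun i hi => controlledNot_of_ne hi _ _
    have h3b : x3 b = x b := by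
      rw [hx3, controlledNot_same, Finset.prod_empty, h2 b hbt, h1b, add_assoc,
        CharTwo.add_self_eq_zero, add_zero]
    have h3 : ∀ i, i ≠ b → x3 i = x2 i := fun i hi => controlledNot_of_ne hi _ _
    have h3I : ∏ l ∈ I, x3 l = ∏ l ∈ I, x l := by
      rw [hx3, prod_controlledNot hb, hx2, prod_controlledNot ht, hx1, prod_controlledNot hb]
    by_cases hit : i = t
    · subst hit
      rw [controlledNot_same, controlledNot_same, Finset.prod_insert hb, h3 i hbt.symm, h2t, h3b,
        h3I]
      linear_combination - CharTwo.add_self_eq_zero (x b * ∏ l ∈ I, x l)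
    · rw [controlledNot_of_ne hit, controlledNot_of_ne hit]
      by_cases hib : i = b
      · rw [hib, h3b]
      · rw [h3 i hib, h2 i hit, h1 i hib]
  rw [key]
  simp only [map_mul]
  have h : ∀ a b : ℤˣ, a * (b * a * b) = 1 := by decide
  exact h _ _

/-- A gate touches at most 3 lines, so `4 ≤ n` leaves a free line. -/
theorem RevCircuit.exists_even_perm (hn : 4 ≤ n) (S : RevCircuit n) :
    ∃ g : Equiv.Perm (BinVec n), (∀ x, g x = S.eval x) ∧ Equiv.Perm.sign g = 1 := by
  induction S with
  | nil => exact ⟨1, fun _ => rfl, map_one _⟩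
  | cons E S ih =>
    obtain ⟨g, hg, hsign⟩ := ih
    obtain ⟨b, hb⟩ : ∃ b, b ∉ insert E.target E.controls := by
      by_contra! h
      have h1 := Finset.card_le_card (fun x _ => h x : Finset.univ ⊆ insert E.target E.controls)
      have h2 := Finset.card_insert_le E.target E.controls
      have h3 := E.card_le
      rw [Finset.card_univ, Fintype.card_fin] at h1
      omega
    rw [Finset.mem_insert, not_or] at hb
    refine ⟨g * controlledNotPerm E.target_notMem, fun x => hg _, ?_⟩
    rw [map_mul, hsign, sign_controlledNotPerm E.target_notMem hb.2 hb.1, one_mul]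

theorem Computes.sign_eq_one (hn : 4 ≤ n) {c : ℕ} {g : Equiv.Perm (BinVec n)}
    (hg : Computes c g) : Equiv.Perm.sign g = 1 := by
  obtain ⟨S, -, hS⟩ := hg
  obtain ⟨h, hh, hsign⟩ := S.exists_even_perm hn
  rwa [show g = h from Equiv.ext fun x => ((hh x).trans (hS x)).symm]

/-- A product of disjoint transpositions of `2 ^ (m + 1)` vectors costs linearly many gates. -/
theorem exists_transpositions {m : ℕ} (hm : 1 ≤ m) (hn : 3 * 2 ^ 2 ^ (m + 1) ≤ n)
    {v : (Fin (m + 1) → ZMod 2) → BinVec n} (hv : Injective v) :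
    ∃ τ : Equiv.Perm (BinVec n), Computes (18 * n) τ ∧
      (∀ u, τ (v u) = v (update u 0 (u 0 + 1))) ∧ ∀ z, z ∉ Set.range v → τ z = z := by
  have hmn : m + 1 ≤ n := by
    have h1 := (Nat.lt_two_pow_self (n := m + 1)).trans (Nat.lt_two_pow_self (n := 2 ^ (m + 1)))
    omega
  let w : (Fin (m + 1) → ZMod 2) → BinVec n := fun u i =>
    if h : i.val < m + 1 then u ⟨i, h⟩ else 1
  have hwcast : ∀ u i, w u (Fin.castLE hmn i) = u i := fun u i => by
    simp only [w, Fin.val_castLE, dif_pos i.is_lt]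
  have hw1 : ∀ u i, ¬ i.val < m + 1 → w u i = 1 := fun u i hi => by
    simp only [w, dif_neg hi]
  have hw : Injective w := fun u u' h => funext fun i => by
    rw [← hwcast u, h, hwcast]
  obtain ⟨σ, hσ, hσv⟩ := (Reach.of_injective hv hw (by simpa [ZMod.card] using hn)).exists_perm
  let t : Fin n := Fin.castLE hmn 0
  let b : Fin n := Fin.castLE hmn ⟨1, by omega⟩
  let I : Finset (Fin n) := Finset.univ.filter fun i => ¬ i.val < m + 1
  have ht : t ∉ I := by simp [I, t]
  have hb : b ∉ I := by simp [I, b]; omega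
  have hbt : b ≠ t := by simp [b, t, Fin.ext_iff]
  have hM : Computes (8 * n) (controlledNotPerm ht) := Computes.controlledNot ht hb hbt
  -- Cost `5 n + 8 n + 5 n`.
  refine ⟨σ⁻¹ * (controlledNotPerm ht * σ), (hσ.inv.mul (hM.mul hσ)).mono (by omega), fun u => ?_,
    fun z hz => ?_⟩
  · rw [Equiv.Perm.mul_apply, Equiv.Perm.mul_apply, hσv, Equiv.Perm.inv_eq_iff_eq, hσv]
    ext i
    change controlledNot t I (w u) i = _
    by_cases hit : i = t
    · rw [hit, controlledNot_same, hwcast, hwcast, update_self, Finset.prod_eq_one]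
      intro i hi
      exact hw1 u i (by simpa [I] using hi)
    · rw [controlledNot_of_ne hit]
      by_cases hi : i.val < m + 1
      · have : i = Fin.castLE hmn ⟨i, hi⟩ := rfl
        rw [this, hwcast, hwcast, update_of_ne]
        rintro h
        exact hit (this.trans (congrArg _ h))
      · rw [hw1 _ i hi, hw1 _ i hi]
  · rw [Equiv.Perm.mul_apply, Equiv.Perm.mul_apply, Equiv.Perm.inv_eq_iff_eq]
    change controlledNot t I (σ z) = σ z
    have h0 : ∏ i ∈ I, σ z i = 0 := by
      by_contra h0
      let u : Fin (m + 1) → ZMod 2 := fun i => σ z (Fin.castLE hmn i)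
      suffices w u = σ z from hz ⟨u, σ.injective ((hσv u).trans this)⟩
      funext i
      by_cases hi : i.val < m + 1
      · have : i = Fin.castLE hmn ⟨i, hi⟩ := rfl
        rw [this]
        exact hwcast u _
      · exact (hw1 u i hi).trans (zmod_two_eq_one_of_ne_zero
          (Finset.prod_ne_zero_iff.1 h0 i (by simpa [I] using hi))).symm
    rw [controlledNot, h0, add_zero, update_eq_self]

/-- A product of two disjoint transpositions costs linearly many gates. -/
theorem Computes.swap_mul_swap_of_disjoint (hn : 48 ≤ n) {x y p q : BinVec n} (hxy : x ≠ y)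
    (hpq : p ≠ q) (hxp : x ≠ p) (hxq : x ≠ q) (hyp : y ≠ p) (hyq : y ≠ q) :
    Computes (18 * n) ⇑(Equiv.swap x y * Equiv.swap p q) := by
  let v : (Fin 2 → ZMod 2) → BinVec n := fun u =>
    if u 1 = 0 then (if u 0 = 0 then x else y) else (if u 0 = 0 then p else q)
  have hu : ∀ u : Fin 2 → ZMod 2, u = ![0, 0] ∨ u = ![1, 0] ∨ u = ![0, 1] ∨ u = ![1, 1] := by
    decide
  have v00 : v ![0, 0] = x := by simp [v]
  have v10 : v ![1, 0] = y := by simp [v]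
  have v01 : v ![0, 1] = p := by simp [v]
  have v11 : v ![1, 1] = q := by simp [v]
  have hv : Injective v := by
    intro u u' h
    rcases hu u with rfl | rfl | rfl | rfl <;> rcases hu u' with rfl | rfl | rfl | rfl <;>
      simp_all
  obtain ⟨τ, hτ, hτv, hτz⟩ := exists_transpositions (m := 1) le_rfl (by simpa using hn) hv
  have hx := hτv ![0, 0]
  have hy := hτv ![1, 0]
  have hp := hτv ![0, 1]
  have hq := hτv ![1, 1]
  rw [show update (![0, 0] : Fin 2 → ZMod 2) 0 (![0, 0] 0 + 1) = ![1, 0] by decide, v00, v10] at hx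
  rw [show update (![1, 0] : Fin 2 → ZMod 2) 0 (![1, 0] 0 + 1) = ![0, 0] by decide, v00, v10] at hy
  rw [show update (![0, 1] : Fin 2 → ZMod 2) 0 (![0, 1] 0 + 1) = ![1, 1] by decide, v01, v11] at hp
  rw [show update (![1, 1] : Fin 2 → ZMod 2) 0 (![1, 1] 0 + 1) = ![0, 1] by decide, v01, v11] at hq
  convert hτ using 2
  ext1 z
  rw [Equiv.Perm.mul_apply]
  by_cases h1 : z = x
  · rw [h1, hx, Equiv.swap_apply_of_ne_of_ne hxp hxq, Equiv.swap_apply_left]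
  by_cases h2 : z = y
  · rw [h2, hy, Equiv.swap_apply_of_ne_of_ne hyp hyq, Equiv.swap_apply_right]
  by_cases h3 : z = p
  · rw [h3, hp, Equiv.swap_apply_left, Equiv.swap_apply_of_ne_of_ne hxq.symm hyq.symm]
  by_cases h4 : z = q
  · rw [h4, hq, Equiv.swap_apply_right, Equiv.swap_apply_of_ne_of_ne hxp.symm hyp.symm]
  rw [Equiv.swap_apply_of_ne_of_ne h3 h4, Equiv.swap_apply_of_ne_of_ne h1 h2, hτz]
  rintro ⟨u, rfl⟩
  rcases hu u with rfl | rfl | rfl | rfl <;> simp_all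

/-- The transpositions may overlap, so `swap p q` with `p`, `q` away from all four points is
inserted twice. -/
theorem Computes.swap_mul_swap (hn : 48 ≤ n) {x y z w : BinVec n} (hxy : x ≠ y) (hzw : z ≠ w) :
    Computes (36 * n) ⇑(Equiv.swap x y * Equiv.swap z w) := by
  classical
  have hcard : 1 < ({x, y, z, w}ᶜ : Finset (BinVec n)).card := by
    rw [Finset.card_compl]
    have h1 : ({x, y, z, w} : Finset (BinVec n)).card ≤ 4 := Finset.card_le_four
    have h2 : 2 ^ 3 ≤ 2 ^ n := Nat.pow_le_pow_right (by norm_num) (by omega)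
    simp only [Fintype.card_fun, ZMod.card, Fintype.card_fin]
    omega
  obtain ⟨p, hp, q, hq, hpq⟩ := Finset.one_lt_card.1 hcard
  simp only [Finset.mem_compl, Finset.mem_insert, Finset.mem_singleton, not_or] at hp hq
  have h1 := Computes.swap_mul_swap_of_disjoint hn hxy hpq (Ne.symm hp.1) (Ne.symm hq.1)
    (Ne.symm hp.2.1) (Ne.symm hq.2.1)
  have h2 := Computes.swap_mul_swap_of_disjoint hn hpq hzw hp.2.2.1 hp.2.2.2 hq.2.2.1 hq.2.2.2
  have h := (h1.mul h2).mono (show _ ≤ 36 * n by omega)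
  rwa [mul_assoc, ← mul_assoc (Equiv.swap p q), Equiv.swap_mul_self, one_mul] at h

/-- Cost of an even permutation in terms of the size of its support. -/
theorem Computes.of_card_support_le (hn : 48 ≤ n) (s : ℕ) (g : Equiv.Perm (BinVec n))
    (hg : Equiv.Perm.sign g = 1) (hs : g.support.card ≤ s) : Computes (36 * n * s) g := by
  induction s using Nat.strong_induction_on generalizing g with
  | _ s ih =>
    by_cases h1 : g = 1
    · subst h1
      exact (Reach.refl _).mono (Nat.zero_le _)
    obtain ⟨x, hx⟩ : ∃ x, g x ≠ x := by
      by_contra! h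
      exact h1 (Equiv.ext h)
    set g' := Equiv.swap x (g x) * g with hg'
    have hsign' : Equiv.Perm.sign g' = -1 := by
      rw [hg', map_mul, hg, Equiv.Perm.sign_swap hx.symm, mul_one]
    -- An odd permutation is not the identity, so a second transposition can be split off, restoring
    -- evenness.
    obtain ⟨z, hz⟩ : ∃ z, g' z ≠ z := by
      by_contra! h
      rw [show g' = 1 from Equiv.ext h, map_one] at hsign'
      exact absurd hsign' (by decide)
    set g'' := Equiv.swap z (g' z) * g' with hg''
    have hsign'' : Equiv.Perm.sign g'' = 1 := by
      rw [hg'', map_mul, hsign', Equiv.Perm.sign_swap hz.symm]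
      decide
    have hc1 : g'.support.card < g.support.card := Equiv.Perm.card_support_swap_mul hx
    have hc2 : g''.support.card < g'.support.card := Equiv.Perm.card_support_swap_mul hz
    have h := ih (s - 1) (by omega) g'' hsign'' (by omega)
    have h2 := (Computes.swap_mul_swap hn hx.symm hz.symm).mul h
    have : Equiv.swap x (g x) * Equiv.swap z (g' z) * g'' = g := by
      rw [hg'', mul_assoc, ← mul_assoc (Equiv.swap z (g' z)), Equiv.swap_mul_self, one_mul, hg',
        ← mul_assoc, Equiv.swap_mul_self, one_mul]
    rw [this] at h2
    refine h2.mono ?_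
    obtain ⟨s, rfl⟩ : ∃ r, s = r + 1 := ⟨s - 1, by omega⟩
    simp only [Nat.add_sub_cancel]
    linarith [Nat.mul_succ (36 * n) s]

/-- Greedy choice: each chosen `x` excludes only `x`, `g x` and `g⁻¹ x`. -/
theorem Equiv.Perm.exists_disjoint_image {α : Type*} [Fintype α] [DecidableEq α]
    (g : Equiv.Perm α) (k : ℕ)
    (hk : 3 * k ≤ g.support.card + 2) :
    ∃ X : Finset α, X ⊆ g.support ∧ X.card = k ∧ ∀ x ∈ X, g x ∉ X := by
  induction k with
  | zero => exact ⟨∅, by simp, rfl, by simp⟩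
  | succ k ih =>
    obtain ⟨X, hX, hXk, hgX⟩ := ih (by omega)
    obtain ⟨x, hx, hxX⟩ : ∃ x ∈ g.support, x ∉ X ∪ X.image g ∪ X.image g.symm := by
      by_contra! h
      have h0 := Finset.card_le_card h
      have h1 := Finset.card_union_le (X ∪ X.image g) (X.image g.symm)
      have h2 := Finset.card_union_le X (X.image g)
      have h3 := Finset.card_image_le (s := X) (f := g)
      have h4 := Finset.card_image_le (s := X) (f := g.symm)
      omega
    simp only [Finset.mem_union, Finset.mem_image, not_or, not_exists, not_and] at hxX
    obtain ⟨⟨h1, h2⟩, h3⟩ := hxX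
    refine ⟨insert x X, Finset.insert_subset hx hX, by rw [Finset.card_insert_of_notMem h1, hXk],
      fun y hy => ?_⟩
    rw [Finset.mem_insert, not_or]
    rcases Finset.mem_insert.1 hy with rfl | hy
    · exact ⟨Equiv.Perm.mem_support.1 hx, fun h => h3 _ h (by simp)⟩
    · exact ⟨h2 y hy, hgX y hy⟩

/-- Few gates suffice to reduce a large support by `2 ^ m`. -/
theorem exists_reduction {m : ℕ} (hm : 1 ≤ m) (hn : 3 * 2 ^ 2 ^ (m + 1) ≤ n)
    (g : Equiv.Perm (BinVec n)) (hg : 3 * 2 ^ m ≤ g.support.card) :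
    ∃ τ : Equiv.Perm (BinVec n), Computes (18 * n) τ ∧
      (τ * g).support.card + 2 ^ m ≤ g.support.card := by
  obtain ⟨X, hX, hXcard, hgX⟩ := g.exists_disjoint_image (2 ^ m) (by omega)
  let e : (Fin m → ZMod 2) ≃ X := Fintype.equivOfCardEq (by simp [ZMod.card, hXcard])
  -- Coordinate 0 distinguishes `x` from `g x`, so the transpositions obtained exchange these two.
  let v : (Fin (m + 1) → ZMod 2) → BinVec n := fun u =>
    if u 0 = 0 then e (Fin.tail u) else g (e (Fin.tail u))
  have hv : Injective v := by
    intro u u' h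
    have htail : u 0 = u' 0 → Fin.tail u = Fin.tail u' → u = u' := fun h0 ht => by
      rw [← Fin.cons_self_tail u, ← Fin.cons_self_tail u', h0, ht]
    simp only [v] at h
    split_ifs at h with h0 h0' h0'
    · exact htail (h0.trans h0'.symm) (e.injective (Subtype.ext h))
    · exact (hgX _ (e _).2 (h ▸ (e _).2)).elim
    · exact (hgX _ (e _).2 (h ▸ (e _).2)).elim
    · exact htail ((zmod_two_eq_one_of_ne_zero h0).trans (zmod_two_eq_one_of_ne_zero h0').symm)
        (e.injective (Subtype.ext (g.injective h)))
  obtain ⟨τ, hτ, hτv, hτz⟩ := exists_transpositions hm hn hv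
  refine ⟨τ, hτ, ?_⟩
  have hrange : ∀ u, v u ∈ g.support := by
    intro u
    simp only [v]
    split_ifs
    · exact hX (e _).2
    · exact Equiv.Perm.apply_mem_support.2 (hX (e _).2)
  have hfix : ∀ x ∈ X, τ (g x) = x := by
    intro x hx
    obtain ⟨a, ha⟩ := e.surjective ⟨x, hx⟩
    have := hτv (Fin.cons 1 a)
    have h0 : (1 + 1 : ZMod 2) = 0 := by decide
    simpa [v, ha, h0] using this
  have hsub : (τ * g).support ⊆ g.support \ X := by
    intro z hz
    rw [Equiv.Perm.mem_support, Equiv.Perm.mul_apply] at hz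
    rw [Finset.mem_sdiff]
    have hzX : z ∉ X := fun h => hz (hfix z h)
    refine ⟨?_, hzX⟩
    by_contra h
    have hgz := Equiv.Perm.notMem_support.1 h
    rw [hgz] at hz
    exact hz (hτz z fun ⟨u, hu⟩ => h (hu ▸ hrange u))
  have := Finset.card_le_card hsub
  rw [Finset.card_sdiff_of_subset hX, hXcard] at this
  have h2 := Finset.card_le_card hX
  omega

/-- Every even permutation is computed by a circuit of bounded size. -/
theorem Computes.of_sign_eq_one {m : ℕ} (hm : 1 ≤ m) (hn : 3 * 2 ^ 2 ^ (m + 1) ≤ n)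
    (g : Equiv.Perm (BinVec n)) (hg : Equiv.Perm.sign g = 1) :
    Computes (18 * n * (2 ^ n / 2 ^ m + 6 * 2 ^ m)) g := by
  have h48 : 48 ≤ n := by
    have h1 : 2 ^ 2 ≤ 2 ^ (m + 1) := Nat.pow_le_pow_right (by norm_num) (by omega)
    have h2 : 2 ^ 2 ^ 2 ≤ 2 ^ 2 ^ (m + 1) := Nat.pow_le_pow_right (by norm_num) h1
    omega
  have key : ∀ (s : ℕ) (g : Equiv.Perm (BinVec n)), Equiv.Perm.sign g = 1 →
      g.support.card ≤ s → Computes (18 * n * (s / 2 ^ m + 6 * 2 ^ m)) g := by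
    intro s
    induction s using Nat.strong_induction_on with
    | _ s ih =>
      intro g hg hs
      by_cases hsmall : g.support.card ≤ 3 * 2 ^ m
      · refine (Computes.of_card_support_le h48 _ g hg hsmall).mono ?_
        calc 36 * n * (3 * 2 ^ m) = 18 * n * (6 * 2 ^ m) := by ring
          _ ≤ _ := Nat.mul_le_mul_left _ (Nat.le_add_left _ _)
      · obtain ⟨τ, hτ, hτg⟩ := exists_reduction hm hn g (by omega)
        have hpos : 0 < 2 ^ m := by positivity
        have h := ih (s - 2 ^ m) (by omega) (τ * g) (by
          rw [map_mul, hg, hτ.sign_eq_one (by omega), one_mul]) (by omega)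
        have h2 := hτ.inv.mul h
        rw [inv_mul_cancel_left] at h2
        refine h2.mono ?_
        have : s / 2 ^ m = (s - 2 ^ m) / 2 ^ m + 1 := Nat.div_eq_sub_div hpos (by omega)
        rw [this]
        exact le_of_eq (by ring)
  refine key _ g hg ((Finset.card_le_univ _).trans ?_)
  simp [ZMod.card]

end EvenPermutations

/-! ### From circuits to the Shannon function -/

section ShannonComplexity

variable {n : ℕ}

theorem RevCircuit.realizes_zero_iff {S : RevCircuit n} {f : BinVec n → BinVec n} :
    RevCircuit.Realizes (n := n) (q := 0) S f ↔
      ∃ π : Equiv.Perm (Fin n), ∀ x i, S.eval x (π i) = f x i := by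
  have h : ∀ x : BinVec n, Fin.append x (fun _ : Fin 0 => (0 : ZMod 2)) = x := fun x => by
    ext i
    exact Fin.append_left x _ i
  unfold RevCircuit.Realizes
  simp only [h]
  rfl

theorem minComplexity_le_shannonComplexity {f : BinVec n → BinVec n}
    (hf : f ∈ realizableMaps n 0) : minComplexity f 0 ≤ shannonComplexity n 0 := by
  classical
  exact Finset.le_sup (f := fun f : BinVec n → BinVec n => minComplexity f 0)
    (Finset.mem_filter.2 ⟨Finset.mem_univ f, hf⟩)

theorem exists_realizes_length_le {f : BinVec n → BinVec n} (hf : f ∈ realizableMaps n 0) :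
    ∃ S : RevCircuit n, S.length ≤ shannonComplexity n 0 ∧
      ∃ π : Equiv.Perm (Fin n), ∀ x i, S.eval x (π i) = f x i := by
  obtain ⟨T, hT⟩ := hf
  obtain ⟨S, hS, hlen⟩ := Nat.sInf_mem (s := {l | ∃ S : RevCircuit (n + 0), S.Realizes f ∧
    S.length = l}) ⟨_, T, hT, rfl⟩
  exact ⟨S, hlen.trans_le (minComplexity_le_shannonComplexity ⟨T, hT⟩),
    RevCircuit.realizes_zero_iff.1 hS⟩

/-- The output permutation of a given realization is reused with the cheaper circuit. -/
theorem shannonComplexity_le (hn : 4 ≤ n) {c : ℕ}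
    (hc : ∀ g : Equiv.Perm (BinVec n), Equiv.Perm.sign g = 1 → Computes c g) :
    shannonComplexity n 0 ≤ c := by
  classical
  refine Finset.sup_le fun f hf => ?_
  obtain ⟨T, hT⟩ := (Finset.mem_filter.1 hf).2
  obtain ⟨π, hπ⟩ := RevCircuit.realizes_zero_iff.1 hT
  obtain ⟨g, hg, hsign⟩ := RevCircuit.exists_even_perm hn T
  obtain ⟨S, hS, hSg⟩ := hc g hsign
  have hSf : RevCircuit.Realizes (n := n) (q := 0) S f :=
    RevCircuit.realizes_zero_iff.2 ⟨π, fun x i => by rw [← hπ, ← hg, ← hSg, id]⟩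
  exact (Nat.sInf_le (show S.length ∈ {l | ∃ S : RevCircuit (n + 0), S.Realizes f ∧ S.length = l} from
    ⟨S, hSf, rfl⟩)).trans hS

/-- The empty circuit fixes `0` under any reordering of outputs, unlike a NOT. -/
theorem one_le_shannonComplexity (hn : 0 < n) : 1 ≤ shannonComplexity n 0 := by
  let t : Fin n := ⟨0, hn⟩
  have hf : controlledNot t ∅ ∈ realizableMaps n 0 :=
    ⟨[⟨t, ∅, by simp, by simp⟩], RevCircuit.realizes_zero_iff.2 ⟨1, fun _ _ => rfl⟩⟩
  obtain ⟨S, hS, π, hπ⟩ := exists_realizes_length_le hf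
  by_contra! h
  obtain rfl : S = [] := List.length_eq_zero_iff.1 (by omega)
  have := hπ 0 t
  rw [controlledNot_same, RevCircuit.eval_nil] at this
  simp at this

/-! ### Counting circuits -/

/-- Gates encoded by a target line and two optional control lines. -/
abbrev GateCode (n : ℕ) : Type := Fin n × Option (Fin n) × Option (Fin n)

/-- The action of an optional encoded gate. -/
def GateCode.act : Option (GateCode n) → BinVec n → BinVec n
  | none, x => x
  | some (t, a, b), x => controlledNot t (a.toFinset ∪ b.toFinset) x

theorem RevGate.exists_code (E : RevGate n) :
    ∃ o : GateCode n, ∀ x, GateCode.act (some o) x = E.apply x := by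
  obtain ⟨a, b, hab⟩ : ∃ a b : Option (Fin n), E.controls = a.toFinset ∪ b.toFinset := by
    have hE := E.card_le
    interval_cases h : E.controls.card
    · exact ⟨none, none, by simpa using h⟩
    · obtain ⟨x, hx⟩ := Finset.card_eq_one.1 h
      exact ⟨some x, none, by simpa using hx⟩
    · obtain ⟨x, y, -, hxy⟩ := Finset.card_eq_two.1 h
      exact ⟨some x, some y, by rw [hxy]; rfl⟩
  exact ⟨(E.target, a, b), fun x => by rw [RevGate.apply_eq_controlledNot, hab]; rfl⟩

/-- Padding with `none` makes all codes equally long. -/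
theorem RevCircuit.exists_code (S : RevCircuit n) {s : ℕ} (hS : S.length ≤ s) :
    ∃ w : Fin s → Option (GateCode n),
      ∀ x, (List.ofFn w).foldl (fun y o => GateCode.act o y) x = S.eval x := by
  induction s generalizing S with
  | zero =>
    obtain rfl : S = [] := List.length_eq_zero_iff.1 (by omega)
    exact ⟨fun _ => none, fun _ => rfl⟩
  | succ s ih =>
    cases S with
    | nil =>
      obtain ⟨w, hw⟩ := ih [] (Nat.zero_le _)
      exact ⟨Fin.cons none w, fun x => by
        rw [List.ofFn_cons, List.foldl_cons, hw]
        rfl⟩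
    | cons E S =>
      obtain ⟨w, hw⟩ := ih S (by simpa using hS)
      obtain ⟨o, ho⟩ := E.exists_code
      exact ⟨Fin.cons (some o) w, fun x => by
        rw [List.ofFn_cons, List.foldl_cons, hw, ho]
        rfl⟩

/-- The bound `c` does not enter the estimate; `hc` only makes every even permutation realizable. -/
theorem factorial_le_of_even_perms_computable {c : ℕ}
    (hc : ∀ g : Equiv.Perm (BinVec n), Equiv.Perm.sign g = 1 → Computes c g) (hn : 0 < n) :
    (2 ^ n).factorial ≤ 2 * ((n * ((n + 1) * (n + 1)) + 1) ^ shannonComplexity n 0 * n.factorial) := by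
  classical
  have hcode : ∀ g : alternatingGroup (BinVec n),
      ∃ d : (Fin (shannonComplexity n 0) → Option (GateCode n)) × Equiv.Perm (Fin n), ∀ x i,
        (List.ofFn d.1).foldl (fun y o => GateCode.act o y) x (d.2 i) = g.1 x i := by
    rintro ⟨g, hg⟩
    obtain ⟨T, -, hT⟩ := hc g (Equiv.Perm.mem_alternatingGroup.1 hg)
    obtain ⟨S, hS, π, hπ⟩ := exists_realizes_length_le (f := g)
      ⟨T, RevCircuit.realizes_zero_iff.2 ⟨1, fun x i => congrFun (hT x) i⟩⟩
    obtain ⟨w, hw⟩ := S.exists_code hS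
    exact ⟨(w, π), fun x i => by rw [hw]; exact hπ x i⟩
  choose d hd using hcode
  have hinj : Injective d := fun g h hgh => by
    refine Subtype.ext (Equiv.ext fun x => funext fun i => ?_)
    rw [← hd, ← hd, hgh]
  have hcard := Fintype.card_le_of_injective d hinj
  have : Nonempty (Fin n) := ⟨⟨0, hn⟩⟩
  have hA := two_mul_card_alternatingGroup (α := BinVec n)
  simp only [Fintype.card_prod, Fintype.card_fun, Fintype.card_option, Fintype.card_fin,
    Fintype.card_perm, ZMod.card] at hcard hA
  rw [← hA]
  exact Nat.mul_le_mul_left 2 hcard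

theorem mul_two_pow_le_of_factorial_le {p l s : ℕ} (hl : p + 2 ≤ 2 ^ (l + 1))
    (h : (2 ^ (p + 1)).factorial ≤
      2 * (((p + 1) * ((p + 1 + 1) * (p + 1 + 1)) + 1) ^ s * (p + 1).factorial)) :
    p * 2 ^ p ≤ 1 + 3 * (l + 1) * s + (l + 1) * (p + 1) := by
  -- The upper half of the factors of the factorial all exceed `2 ^ p`.
  have h1 : 2 ^ (p * 2 ^ p) ≤ (2 ^ (p + 1)).factorial := by
    rw [pow_succ 2 p, mul_two]
    have := Nat.factorial_mul_pow_le_factorial (m := 2 ^ p) (n := 2 ^ p)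
    refine le_trans ?_ (this.trans' (Nat.le_mul_of_pos_left _ (Nat.factorial_pos _)))
    rw [pow_mul]
    exact Nat.pow_le_pow_left (Nat.le_succ _) _
  have h2 : (p + 1) * ((p + 1 + 1) * (p + 1 + 1)) + 1 ≤ 2 ^ (3 * (l + 1)) := by
    calc (p + 1) * ((p + 1 + 1) * (p + 1 + 1)) + 1 ≤ (p + 2) ^ 3 := by ring_nf; nlinarith
      _ ≤ (2 ^ (l + 1)) ^ 3 := Nat.pow_le_pow_left hl _
      _ = 2 ^ (3 * (l + 1)) := by rw [← pow_mul, mul_comm]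
  have h3 : (p + 1).factorial ≤ 2 ^ ((l + 1) * (p + 1)) := by
    calc (p + 1).factorial ≤ (p + 1) ^ (p + 1) := Nat.factorial_le_pow _
      _ ≤ (2 ^ (l + 1)) ^ (p + 1) := Nat.pow_le_pow_left (by omega) _
      _ = _ := (pow_mul _ _ _).symm
  rw [← Nat.pow_le_pow_iff_right (a := 2) one_lt_two, pow_add, pow_add, pow_mul 2 (3 * (l + 1)),
    pow_one, mul_assoc]
  exact (h1.trans h).trans (Nat.mul_le_mul_left _ (Nat.mul_le_mul (Nat.pow_le_pow_left h2 _) h3))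

/-! ### Choice of `m` and numerical bounds -/

theorem sixteen_mul_sq_le_two_pow (hn : 64 ≤ n) : 16 * n ^ 2 ≤ 2 ^ n := by
  induction n, hn using Nat.le_induction with
  | base => norm_num
  | succ n hn ih =>
    rw [pow_succ 2 n]
    nlinarith

/-- `2 ^ (m + 1)` is the largest power of two up to `l - 2`, where `l = ⌊log₂ n⌋`; the `2` pays for
the factor 3, as `3 ≤ 2 ^ 2`. -/
theorem exists_parameter (hn : 64 ≤ n) : ∃ m, 1 ≤ m ∧ 3 * 2 ^ 2 ^ (m + 1) ≤ n ∧
    Nat.log 2 n + 1 ≤ 8 * 2 ^ m ∧ 2 ^ m ≤ n := by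
  set l := Nat.log 2 n with hl
  have hl6 : 6 ≤ l := Nat.le_log_of_pow_le one_lt_two (by simpa using hn)
  have hln : 2 ^ l ≤ n := Nat.pow_log_le_self 2 (by omega)
  have h2 : 2 ≤ Nat.log 2 (l - 2) := Nat.le_log_of_pow_le one_lt_two (by omega)
  obtain ⟨m, hm⟩ : ∃ m, Nat.log 2 (l - 2) = m + 1 := ⟨Nat.log 2 (l - 2) - 1, by omega⟩
  have h3 : 2 ^ (m + 1) ≤ l - 2 := hm ▸ Nat.pow_log_le_self 2 (by omega)
  have h4 : l - 2 < 2 ^ (m + 1 + 1) := hm ▸ Nat.lt_pow_succ_log_self one_lt_two _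
  have h5 : 2 ^ 2 ^ (m + 1) ≤ 2 ^ (l - 2) := Nat.pow_le_pow_right two_pos h3
  have h6 : 2 ^ l = 2 ^ (l - 2) * 4 := by
    rw [← show 2 ^ 2 = 4 by norm_num, ← pow_add]
    congr 1
    omega
  have h7 : 2 ^ (m + 1) = 2 ^ m * 2 := pow_succ _ _
  have h8 : 2 ^ (m + 1 + 1) = 2 ^ (m + 1) * 2 := pow_succ _ _
  have h9 : l < 2 ^ l := Nat.lt_two_pow_self
  refine ⟨m, by omega, by omega, by omega, by omega⟩

theorem log_le_logb (hn : 0 < n) : (Nat.log 2 n : ℝ) ≤ Real.logb 2 n := by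
  rw [Real.le_logb_iff_rpow_le one_lt_two (by exact_mod_cast hn), Real.rpow_natCast]
  exact_mod_cast Nat.pow_log_le_self 2 hn.ne'

theorem logb_le_log_add_one (hn : 0 < n) : Real.logb 2 n ≤ Nat.log 2 n + 1 := by
  rw [Real.logb_le_iff_le_rpow one_lt_two (by exact_mod_cast hn)]
  have h := (Nat.lt_pow_succ_log_self one_lt_two n).le
  have h2 : ((2 : ℝ) ^ ((Nat.log 2 n : ℝ) + 1)) = ((2 ^ (Nat.log 2 n + 1) : ℕ) : ℝ) := by
    push_cast
    rw [← Real.rpow_natCast]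
    push_cast
    rfl
  rw [h2]
  exact_mod_cast h

theorem shannonComplexity_lower (hn : 64 ≤ n) :
    (n : ℝ) * 2 ^ n ≤ 48 * (shannonComplexity n 0 * Real.logb 2 n) := by
  obtain ⟨m, hm, hmn, -, -⟩ := exists_parameter hn
  have hfac := factorial_le_of_even_perms_computable (Computes.of_sign_eq_one hm hmn) (by omega)
  set s := shannonComplexity n 0
  have hlog := log_le_logb (n := n) (by omega)
  have hl1 : 1 ≤ Nat.log 2 n := Nat.le_log_of_pow_le one_lt_two (by omega)
  have hln : Nat.log 2 n + 1 ≤ n := Nat.log_lt_self 2 (by omega)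
  have hlt : n < 2 ^ (Nat.log 2 n + 1) := Nat.lt_pow_succ_log_self one_lt_two n
  set l := Nat.log 2 n
  obtain ⟨p, rfl⟩ : ∃ p, n = p + 1 := ⟨n - 1, by omega⟩
  have h1 := mul_two_pow_le_of_factorial_le (l := l) hlt hfac
  have h2 := sixteen_mul_sq_le_two_pow hn
  have h3 : (l + 1) * (p + 1) ≤ (p + 1) ^ 2 := by
    rw [sq]
    exact Nat.mul_le_mul_right _ hln
  have h4 : (p + 1) * 2 ^ (p + 1) ≤ 4 * (p * 2 ^ p) := by
    have := Nat.mul_le_mul_right (2 ^ p) (show p + 1 ≤ 2 * p by omega)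
    rw [pow_succ]
    nlinarith
  have h5 : 2 ^ (p + 1) ≤ (p + 1) * 2 ^ (p + 1) := Nat.le_mul_of_pos_left _ (by omega)
  have h6 : 1 ≤ (p + 1) ^ 2 := Nat.one_le_pow _ _ (by omega)
  -- The terms without `s` are at most half of the left side by `h2`.
  have h7 : (p + 1) * 2 ^ (p + 1) ≤ 24 * ((l + 1) * s) := by nlinarith
  have h8 : (p + 1) * 2 ^ (p + 1) ≤ 48 * (s * l) := by nlinarith
  have h9 : ((p + 1 : ℕ) : ℝ) * 2 ^ (p + 1) ≤ 48 * (s * l) := by exact_mod_cast h8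
  refine h9.trans ?_
  gcongr

theorem shannonComplexity_upper (hn : 64 ≤ n) :
    (shannonComplexity n 0 : ℝ) * Real.logb 2 n ≤ 252 * (n * 2 ^ n) := by
  obtain ⟨m, hm, hmn, hm8, hmn'⟩ := exists_parameter hn
  have h := shannonComplexity_le (by omega) (Computes.of_sign_eq_one hm hmn)
  have hlog := logb_le_log_add_one (n := n) (by omega)
  have hln : Nat.log 2 n + 1 ≤ n := Nat.log_lt_self 2 (by omega)
  set s := shannonComplexity n 0
  set l := Nat.log 2 n
  have h1 : 2 ^ n / 2 ^ m * (l + 1) ≤ 8 * 2 ^ n := by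
    calc 2 ^ n / 2 ^ m * (l + 1) ≤ 2 ^ n / 2 ^ m * (8 * 2 ^ m) := Nat.mul_le_mul_left _ hm8
      _ = 8 * (2 ^ n / 2 ^ m * 2 ^ m) := by ring
      _ ≤ 8 * 2 ^ n := Nat.mul_le_mul_left _ (Nat.div_mul_le_self _ _)
  have h2 : 2 ^ m * (l + 1) ≤ 2 ^ n := by
    have := Nat.mul_le_mul hmn' hln
    have := sixteen_mul_sq_le_two_pow hn
    nlinarith
  have h3 : s * (l + 1) ≤ 252 * (n * 2 ^ n) := by
    calc s * (l + 1) ≤ 18 * n * (2 ^ n / 2 ^ m + 6 * 2 ^ m) * (l + 1) := Nat.mul_le_mul_right _ h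
      _ = 18 * n * (2 ^ n / 2 ^ m * (l + 1) + 6 * (2 ^ m * (l + 1))) := by ring
      _ ≤ 18 * n * (8 * 2 ^ n + 6 * 2 ^ n) := by gcongr
      _ = 252 * (n * 2 ^ n) := by ring
  calc (s : ℝ) * Real.logb 2 n ≤ s * (l + 1) := by gcongr
    _ ≤ 252 * (n * 2 ^ n) := by exact_mod_cast h3

end ShannonComplexity

theorem mainTheorem5 :
    ∃ c₁ c₂ : ℝ, 0 < c₁ ∧ ∀ n : ℕ, 2 ≤ n →
      c₁ < (shannonComplexity n 0 : ℝ) / ((n : ℝ) * 2 ^ n / Real.logb 2 n) ∧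
      (shannonComplexity n 0 : ℝ) / ((n : ℝ) * 2 ^ n / Real.logb 2 n) < c₂ := by
  set F : ℕ → ℝ := fun n => (shannonComplexity n 0 : ℝ) / ((n : ℝ) * 2 ^ n / Real.logb 2 n)
    with hF
  -- For `n < 64`, the sum bounds `F n` above, and `n * 2 ^ n ≤ 2 ^ 70` with complexity at least 1
  -- bounds it below.
  refine ⟨1 / 2 ^ 80, 253 + ∑ n ∈ Finset.range 64, |F n|, by positivity, fun n hn => ?_⟩
  change 1 / 2 ^ 80 < F n ∧ F n < _
  have hlog : 1 ≤ Real.logb 2 n := by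
    rw [Real.le_logb_iff_rpow_le one_lt_two (by positivity), Real.rpow_one]
    exact_mod_cast hn
  have hlog0 : 0 < Real.logb 2 n := by linarith
  have hn0 : (0 : ℝ) < n * 2 ^ n := by positivity
  have hFn : F n = shannonComplexity n 0 * Real.logb 2 n / (n * 2 ^ n) := div_div_eq_mul_div _ _ _
  have hsum : 0 ≤ ∑ n ∈ Finset.range 64, |F n| := Finset.sum_nonneg fun _ _ => abs_nonneg _
  rcases Nat.lt_or_ge n 64 with h | h
  · constructor
    · have hs : (1 : ℝ) ≤ shannonComplexity n 0 := by
        exact_mod_cast one_le_shannonComplexity (by omega)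
      have h1 : (n : ℝ) * 2 ^ n ≤ 64 * 2 ^ 64 := by
        have : n * 2 ^ n ≤ 64 * 2 ^ 64 :=
          Nat.mul_le_mul h.le (Nat.pow_le_pow_right two_pos h.le)
        exact_mod_cast this
      rw [hFn, lt_div_iff₀ hn0]
      calc 1 / 2 ^ 80 * ((n : ℝ) * 2 ^ n) ≤ 1 / 2 ^ 80 * (64 * 2 ^ 64) := by gcongr
        _ < 1 * 1 := by norm_num
        _ ≤ _ := mul_le_mul hs hlog zero_le_one (by positivity)
    · have := Finset.single_le_sum (f := fun n => |F n|) (fun _ _ => abs_nonneg _)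
        (Finset.mem_range.2 h)
      have h2 := le_abs_self (F n)
      linarith
  · constructor
    · rw [hFn, lt_div_iff₀ hn0]
      have := shannonComplexity_lower h
      have h2 : (1 : ℝ) / 2 ^ 80 * (n * 2 ^ n) < 1 / 48 * (n * 2 ^ n) := by
        gcongr
        norm_num
      linarith
    · have : F n ≤ 252 := by
        rw [hFn, div_le_iff₀ hn0]
        exact shannonComplexity_upper h
      linarith
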